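/- Let $X$ be a complex normed space. For $x,y\in X$ put $$\rho_{+}(x,y)=\lim_{t\to0^{+}}\frac{\|x+ty\|^2-\|x\|^2}{2t},\qquad \rho_{\infty}(x,y)=\frac1\pi\int_0^{2\pi}e^{i\theta}\rho_{+}(x,e^{i\theta}y)\,d\theta ,$$ and write $x\perp_{\rho_\infty}y$ if $\rho_\infty(x,y)=0$. A semi-inner product on $X$ (generating its norm) is a map $[\cdot,\cdot]:X\times X\to\mathbb{C}$ such that, for all $x,y,z\in X$ and $\alpha\in\mathbb{C}$, $[\alpha x+y,z]=\alpha[x,z]+[y,z]$, $[x,\alpha y]=\overline{\alpha}[x,y]$, $[x,x]=\|x\|^2$ and $|[x,y]|\le\|x\|\|y\|$. Let $X$ and $Y$ be complex normed spaces and let $T:X\to Y$ be a non-zero bounded linear map. The following conditions are equivalent: (i) $T$ preserves $\rho_\infty$-orthogonality, that is, for all $x,y\in X$, $x\perp_{\rho_\infty}y$ implies $Tx\perp_{\rho_\infty}Ty$; (ii) $\|Tx\|=\|T\|\,\|x\|$ for all $x\in X$; (iii) $\rho_\infty(Tx,Ty)=\|T\|^2\rho_\infty(x,y)$ for all $x,y\in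 X$. If $X=Y$, then each of these conditions is also equivalent to (iv) there exists a semi-inner product $[\cdot,\cdot]$ on $X$ (generating its norm) such that $[Tx,Ty]=\|T\|^2[x,y]$ for all $x,y\in X$. -/

import Mathlib

namespace RhoInfty

open Filter Topology

noncomputable section

/-- The right norm derivative
`ρ₊(x, y) = lim_{t → 0⁺} (‖x + t y‖² - ‖x‖²) / (2 t)`.
The limit always exists, see `tendsto_rhoPlus`. -/
def rhoPlus {X : Type*} [NormedAddCommGroup X] [NormedSpace ℂ X] (x y : X) : ℝ :=
  limUnder (𝓝[>] (0 : ℝ)) (fun t : ℝ => (‖x + (t : ℂ) • y‖ ^ 2 - ‖x‖ ^ 2) / (2 * t))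

/-- `ρ∞(x, y) = (1/π) ∫_0^{2π} e^{iθ} ρ₊(x, e^{iθ} y) dθ`. -/
def rhoInfty {X : Type*} [NormedAddCommGroup X] [NormedSpace ℂ X] (x y : X) : ℂ :=
  (1 / (Real.pi : ℂ)) * ∫ θ in (0 : ℝ)..(2 * Real.pi),
    Complex.exp (θ * Complex.I) * (rhoPlus x (Complex.exp (θ * Complex.I) • y) : ℂ)

/-- `x ⊥_{ρ∞} y`. -/
def RhoInftyOrthogonal {X : Type*} [NormedAddCommGroup X] [NormedSpace ℂ X] (x y : X) : Prop :=
  rhoInfty x y = 0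

/-- `T` preserves `ρ∞`-orthogonality. -/
def PreservesRhoInftyOrthogonality {X Y : Type*} [NormedAddCommGroup X] [NormedSpace ℂ X]
    [NormedAddCommGroup Y] [NormedSpace ℂ Y] (T : X → Y) : Prop :=
  ∀ x y : X, RhoInftyOrthogonal x y → RhoInftyOrthogonal (T x) (T y)

/-- `s` is a semi-inner product on `X` in the sense of Lumer and Giles, generating the given
norm of `X`; `s x y` stands for `[x, y]`. -/
structure IsSemiInnerProduct {X : Type*} [NormedAddCommGroup X] [NormedSpace ℂ X]
    (s : X → X → ℂ) : Prop where
  linear_left : ∀ (α : ℂ) (x y z : X), s (α • x + y) z = α * s x z + s y z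
  conj_smul_right : ∀ (α : ℂ) (x y : X), s x (α • y) = (starRingEnd ℂ) α * s x y
  self_eq : ∀ x : X, s x x = ((‖x‖ ^ 2 : ℝ) : ℂ)
  norm_le : ∀ x y : X, ‖s x y‖ ≤ ‖x‖ * ‖y‖

/-- The limit defining `ρ₊` exists. -/
theorem tendsto_rhoPlus {X : Type*} [NormedAddCommGroup X] [NormedSpace ℂ X] (x y : X) :
    Tendsto (fun t : ℝ => (‖x + (t : ℂ) • y‖ ^ 2 - ‖x‖ ^ 2) / (2 * t)) (𝓝[>] (0 : ℝ))
      (𝓝 (rhoPlus x y)) := by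
  have h1 : ConvexOn ℝ Set.univ (fun t : ℝ => ‖x + (t : ℂ) • y‖) := by
    refine ⟨convex_univ, fun s _ t _ a b ha hb hab => ?_⟩
    have e : x + ((a • s + b • t : ℝ) : ℂ) • y
        = (a : ℂ) • (x + (s : ℂ) • y) + (b : ℂ) • (x + (t : ℂ) • y) := by
      have hab' : (a : ℂ) + (b : ℂ) = 1 := by exact_mod_cast hab
      have hx : x = ((a : ℂ) + (b : ℂ)) • x := by rw [hab', one_smul]
      conv_lhs => rw [hx]
      simp only [smul_eq_mul, Complex.ofReal_add, Complex.ofReal_mul]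
      module
    simp only [e]
    refine (norm_add_le _ _).trans (le_of_eq ?_)
    rw [norm_smul, norm_smul, Complex.norm_of_nonneg ha, Complex.norm_of_nonneg hb]
    rfl
  have h2 : ConvexOn ℝ Set.univ (fun t : ℝ => ‖x + (t : ℂ) • y‖ ^ 2) :=
    h1.pow (fun _ _ => norm_nonneg _) 2
  have h3 := (ConvexOn.hasDerivWithinAt_rightDeriv_of_mem_interior h2 (x := 0) (by simp))
  rw [hasDerivWithinAt_iff_tendsto_slope] at h3
  have h4 := h3.div_const 2
  have hs : Set.Ioi (0 : ℝ) \ {0} = Set.Ioi 0 := by simp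
  simp only [hs] at h4
  refine tendsto_nhds_limUnder ⟨_, h4.congr fun t => ?_⟩
  simp [slope_def_field]
  ring

end

end RhoInfty

namespace RhoInfty

open Filter Topology MeasureTheory

/-! ### Right norm derivatives: sublinearity and behaviour along `x`. -/

section RhoPlus

variable {X : Type*} [NormedAddCommGroup X] [NormedSpace ℂ X]

/-! Since `ρ∞(x, y + μx) = ρ∞(x, y) + conj μ ‖x‖²`, any `y` can be corrected by a multiple of `x` to
become orthogonal to `x`; so (i) forces `‖x‖² ρ∞(Tx, Ty) = ‖Tx‖² ρ∞(x, y)`. The crux is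
`re_rhoInfty_le`, which with oddness gives `-ρ₊(x, -y) ≤ Re ρ∞(x, y) ≤ ρ₊(x, y)`: wherever the
squared norm is differentiable along a line, `Re ρ∞` is half its derivative. Hence `‖T(x + ty)‖² /
‖x + ty‖²` has zero derivative for almost every `t`; being absolutely continuous, it is constant,
which is (ii).

Scaling of `ρ₊` gives (ii) → (iii), and (iii) → (i) is immediate. For (iv), `T / ‖T‖` is an
isometry, and averaging any semi-inner product over its powers makes it invariant; the converse is
the case `x = y`. -/

theorem rhoPlus_eq_of_tendsto {x y : X} {a : ℝ}
    (h : Tendsto (fun t : ℝ => (‖x + (t : ℂ) • y‖ ^ 2 - ‖x‖ ^ 2) / (2 * t)) (𝓝[>] (0 : ℝ)) (𝓝 a)) :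
    rhoPlus x y = a :=
  tendsto_nhds_unique (tendsto_rhoPlus x y) h

theorem tendsto_mul_nhdsGT_zero {r : ℝ} (hr : 0 < r) :
    Tendsto (fun t : ℝ => r * t) (𝓝[>] 0) (𝓝[>] 0) := by
  refine tendsto_nhdsWithin_iff.2 ⟨?_, ?_⟩
  · have : Tendsto (fun t : ℝ => r * t) (𝓝 0) (𝓝 (r * 0)) := (continuous_const_mul r).tendsto 0
    rw [mul_zero] at this
    exact this.mono_left nhdsWithin_le_nhds
  · filter_upwards [self_mem_nhdsWithin] with t ht
    exact mul_pos hr ht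

theorem rhoPlus_add_le (x y z : X) : rhoPlus x (y + z) ≤ rhoPlus x y + rhoPlus x z := by
  -- The factor 2 appears because `x + t(y + z)` is the midpoint of `x + 2ty` and `x + 2tz`.
  have h2 := tendsto_mul_nhdsGT_zero (two_pos)
  refine le_of_tendsto_of_tendsto (tendsto_rhoPlus x (y + z))
    (((tendsto_rhoPlus x y).comp h2).add ((tendsto_rhoPlus x z).comp h2)) ?_
  filter_upwards [self_mem_nhdsWithin] with t ht
  have ht : 0 < t := ht
  simp only [Function.comp]
  have e : x + (t : ℂ) • (y + z)
      = (2⁻¹ : ℂ) • ((x + ((2 * t : ℝ) : ℂ) • y) + (x + ((2 * t : ℝ) : ℂ) • z)) := by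
    push_cast; module
  have hn : ‖x + (t : ℂ) • (y + z)‖
      ≤ 2⁻¹ * (‖x + ((2 * t : ℝ) : ℂ) • y‖ + ‖x + ((2 * t : ℝ) : ℂ) • z‖) := by
    rw [e, norm_smul]
    have : ‖(2⁻¹ : ℂ)‖ = 2⁻¹ := by simp
    rw [this]
    gcongr
    exact norm_add_le _ _
  set a := ‖x + ((2 * t : ℝ) : ℂ) • y‖
  set b := ‖x + ((2 * t : ℝ) : ℂ) • z‖
  have hsq : ‖x + (t : ℂ) • (y + z)‖ ^ 2 ≤ (2⁻¹ * (a + b)) ^ 2 :=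
    pow_le_pow_left₀ (norm_nonneg _) hn 2
  rw [← add_div, div_le_div_iff₀ (by positivity) (by positivity)]
  have : ‖x + (t : ℂ) • (y + z)‖ ^ 2 - ‖x‖ ^ 2 ≤ 2⁻¹ * (a ^ 2 - ‖x‖ ^ 2 + (b ^ 2 - ‖x‖ ^ 2)) := by
    nlinarith [sq_nonneg (a - b)]
  nlinarith

@[simp]
theorem rhoPlus_zero_right (x : X) : rhoPlus x 0 = 0 :=
  rhoPlus_eq_of_tendsto (by simp)

theorem rhoPlus_smul_of_nonneg (x y : X) {r : ℝ} (hr : 0 ≤ r) :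
    rhoPlus x ((r : ℂ) • y) = r * rhoPlus x y := by
  rcases hr.eq_or_lt with rfl | hr
  · simp
  refine rhoPlus_eq_of_tendsto ?_
  refine (((tendsto_rhoPlus x y).comp (tendsto_mul_nhdsGT_zero hr)).const_mul r).congr' ?_
  filter_upwards [self_mem_nhdsWithin] with t ht
  have ht : 0 < t := ht
  have e : ((r * t : ℝ) : ℂ) • y = (t : ℂ) • (r : ℂ) • y := by
    rw [smul_smul, mul_comm]; push_cast; rfl
  simp only [Function.comp, e]
  field_simp

theorem rhoPlus_le (x y : X) : rhoPlus x y ≤ ‖x‖ * ‖y‖ := by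
  have hlim : Tendsto (fun t : ℝ => ‖x‖ * ‖y‖ + t * (‖y‖ ^ 2 / 2)) (𝓝[>] 0) (𝓝 (‖x‖ * ‖y‖)) := by
    have : Tendsto (fun t : ℝ => ‖x‖ * ‖y‖ + t * (‖y‖ ^ 2 / 2)) (𝓝 0)
        (𝓝 (‖x‖ * ‖y‖ + 0 * (‖y‖ ^ 2 / 2))) := Continuous.tendsto (by fun_prop) 0
    rw [zero_mul, add_zero] at this
    exact this.mono_left nhdsWithin_le_nhds
  refine le_of_tendsto_of_tendsto (tendsto_rhoPlus x y) hlim ?_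
  filter_upwards [self_mem_nhdsWithin] with t ht
  have ht : 0 < t := ht
  have hn : ‖x + (t : ℂ) • y‖ ≤ ‖x‖ + t * ‖y‖ := by
    refine (norm_add_le _ _).trans_eq ?_
    rw [norm_smul, Complex.norm_of_nonneg ht.le]
  have hsq := pow_le_pow_left₀ (norm_nonneg _) hn 2
  rw [div_le_iff₀ (by positivity)]
  nlinarith

theorem rhoPlus_sub_le (x y z : X) : rhoPlus x y - rhoPlus x z ≤ ‖x‖ * ‖y - z‖ := by
  have h := rhoPlus_add_le x (y - z) z
  rw [sub_add_cancel] at h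
  linarith [rhoPlus_le x (y - z)]

theorem abs_rhoPlus_sub_le (x y z : X) : |rhoPlus x y - rhoPlus x z| ≤ ‖x‖ * ‖y - z‖ := by
  refine abs_le.2 ⟨?_, rhoPlus_sub_le x y z⟩
  have := rhoPlus_sub_le x z y
  rw [norm_sub_rev] at this
  linarith

theorem rhoPlus_smul_self (x : X) (μ : ℂ) : rhoPlus x (μ • x) = μ.re * ‖x‖ ^ 2 := by
  refine rhoPlus_eq_of_tendsto ?_
  have hlim : Tendsto (fun t : ℝ => (μ.re + t * (‖μ‖ ^ 2 / 2)) * ‖x‖ ^ 2) (𝓝[>] 0)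
      (𝓝 (μ.re * ‖x‖ ^ 2)) := by
    have : Tendsto (fun t : ℝ => (μ.re + t * (‖μ‖ ^ 2 / 2)) * ‖x‖ ^ 2) (𝓝 0)
        (𝓝 ((μ.re + 0 * (‖μ‖ ^ 2 / 2)) * ‖x‖ ^ 2)) := Continuous.tendsto (by fun_prop) 0
    rw [zero_mul, add_zero] at this
    exact this.mono_left nhdsWithin_le_nhds
  refine hlim.congr' ?_
  filter_upwards [self_mem_nhdsWithin] with t ht
  have ht : 0 < t := ht
  have e : x + (t : ℂ) • μ • x = (1 + t * μ) • x := by module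
  rw [e, norm_smul, mul_pow, Complex.sq_norm, Complex.sq_norm, Complex.normSq_apply,
    Complex.normSq_apply]
  simp
  field_simp
  ring

theorem rhoPlus_add_smul_self (x y : X) (μ : ℂ) :
    rhoPlus x (y + μ • x) = rhoPlus x y + μ.re * ‖x‖ ^ 2 := by
  refine le_antisymm ((rhoPlus_add_le _ _ _).trans_eq (by rw [rhoPlus_smul_self])) ?_
  have h := rhoPlus_add_le x (y + μ • x) ((-μ) • x)
  rw [rhoPlus_smul_self, neg_smul, add_neg_cancel_right, Complex.neg_re] at h
  linarith

/-- `ρ₊` at a point of differentiability of the norm along a line. -/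
theorem rhoPlus_eq_of_hasDerivAt {x y : X} {t d : ℝ}
    (h : HasDerivAt (fun s : ℝ => ‖x + (s : ℂ) • y‖ ^ 2) d t) :
    rhoPlus (x + (t : ℂ) • y) y = d / 2 ∧ rhoPlus (x + (t : ℂ) • y) (-y) = -(d / 2) := by
  have h0 := h.tendsto_slope_zero
  constructor
  · refine rhoPlus_eq_of_tendsto ?_
    have h1 := (h0.mono_left (nhdsGT_le_nhdsNE 0)).div_const 2
    refine h1.congr fun s => ?_
    have e : x + (t : ℂ) • y + (s : ℂ) • y = x + ((t + s : ℝ) : ℂ) • y := by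
      push_cast; module
    rw [e, smul_eq_mul]
    field_simp
  · refine rhoPlus_eq_of_tendsto ?_
    have hneg : Tendsto (fun s : ℝ => -s) (𝓝[>] 0) (𝓝[≠] 0) := by
      refine tendsto_nhdsWithin_iff.2 ⟨?_, ?_⟩
      · have : Tendsto (fun s : ℝ => -s) (𝓝 0) (𝓝 (-0)) := continuous_neg.tendsto 0
        rw [neg_zero] at this
        exact this.mono_left nhdsWithin_le_nhds
      · filter_upwards [self_mem_nhdsWithin] with s hs
        exact neg_ne_zero.2 (ne_of_gt hs)
    have h1 := ((h0.comp hneg).div_const 2).neg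
    refine h1.congr fun s => ?_
    have e : x + (t : ℂ) • y + (s : ℂ) • -y = x + ((t + -s : ℝ) : ℂ) • y := by
      push_cast; module
    simp only [Function.comp]
    rw [e, smul_eq_mul, inv_neg]
    field_simp

end RhoPlus

/-! ### The integral `ρ∞` and its comparison with `ρ₊`. -/

section RhoInfty

variable {X : Type*} [NormedAddCommGroup X] [NormedSpace ℂ X]

theorem lipschitzWith_rhoPlus_exp (x y : X) :
    LipschitzWith (‖x‖₊ * ‖y‖₊)
      (fun θ : ℝ => rhoPlus x (Complex.exp (θ * Complex.I) • y)) := by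
  refine LipschitzWith.of_dist_le_mul fun a b => ?_
  rw [Real.dist_eq]
  refine (abs_rhoPlus_sub_le _ _ _).trans ?_
  rw [← sub_smul, norm_smul]
  have h : ‖Complex.exp (a * Complex.I) - Complex.exp (b * Complex.I)‖ ≤ dist a b := by
    have e : Complex.exp (a * Complex.I) - Complex.exp (b * Complex.I)
        = Complex.exp (b * Complex.I) * (Complex.exp (Complex.I * ((a - b : ℝ) : ℂ)) - 1) := by
      rw [mul_sub, mul_one, ← Complex.exp_add]
      congr 2
      push_cast
      ring
    rw [e, norm_mul, Complex.norm_exp_ofReal_mul_I, one_mul, Real.dist_eq]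
    exact Real.norm_exp_I_mul_ofReal_sub_one_le
  have := mul_le_mul_of_nonneg_left h (mul_nonneg (norm_nonneg x) (norm_nonneg y))
  simp only [NNReal.coe_mul, coe_nnnorm]
  linarith

theorem continuous_rhoPlus_exp (x y : X) :
    Continuous (fun θ : ℝ => rhoPlus x (Complex.exp (θ * Complex.I) • y)) :=
  (lipschitzWith_rhoPlus_exp x y).continuous

theorem continuous_exp_mul_rhoPlus_exp (x y : X) :
    Continuous (fun θ : ℝ => Complex.exp (θ * Complex.I)
      * (rhoPlus x (Complex.exp (θ * Complex.I) • y) : ℂ)) := by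
  have := continuous_rhoPlus_exp x y
  fun_prop

/-- The integrand is `(e^{2iθ} μ + conj μ) / 2`, whose oscillating term has mean zero. -/
theorem integral_exp_mul_re (μ : ℂ) :
    ∫ θ in (0 : ℝ)..(2 * Real.pi),
      Complex.exp (θ * Complex.I) * ((Complex.exp (θ * Complex.I) * μ).re : ℂ)
      = Real.pi * (starRingEnd ℂ) μ := by
  have e : ∀ θ : ℝ, Complex.exp (θ * Complex.I) * ((Complex.exp (θ * Complex.I) * μ).re : ℂ)
      = Complex.exp ((2 * Complex.I) * θ) * (μ / 2) + (starRingEnd ℂ) μ / 2 := by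
    intro θ
    rw [Complex.re_eq_add_conj, map_mul, ← Complex.exp_conj]
    have h1 : Complex.exp ((2 * Complex.I) * θ)
        = Complex.exp (θ * Complex.I) * Complex.exp (θ * Complex.I) := by
      rw [← Complex.exp_add]; congr 1; ring
    have h2 : Complex.exp (θ * Complex.I) * Complex.exp ((starRingEnd ℂ) (θ * Complex.I)) = 1 := by
      rw [← Complex.exp_add]; simp
    rw [h1]
    linear_combination ((starRingEnd ℂ) μ / 2) * h2
  have h2I : (2 * Complex.I) ≠ 0 := by simp
  simp only [e]
  rw [intervalIntegral.integral_add (Continuous.intervalIntegrable (by fun_prop) _ _)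
    (Continuous.intervalIntegrable (by fun_prop) _ _), intervalIntegral.integral_mul_const,
    integral_exp_mul_complex h2I]
  have h3 : Complex.exp (2 * Complex.I * ((2 * Real.pi : ℝ) : ℂ)) = 1 := by
    have : 2 * Complex.I * ((2 * Real.pi : ℝ) : ℂ) = ((2 : ℤ) : ℂ) * (2 * Real.pi * Complex.I) := by
      push_cast; ring
    rw [this, Complex.exp_int_mul_two_pi_mul_I]
  rw [h3]
  simp
  ring

theorem rhoInfty_add_smul_self (x y : X) (μ : ℂ) :
    rhoInfty x (y + μ • x) = rhoInfty x y + (starRingEnd ℂ) μ * ((‖x‖ ^ 2 : ℝ) : ℂ) := by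
  have hπ : (Real.pi : ℂ) ≠ 0 := by exact_mod_cast Real.pi_ne_zero
  unfold rhoInfty
  simp only [smul_add, smul_smul, rhoPlus_add_smul_self, Complex.ofReal_add, Complex.ofReal_mul,
    mul_add, ← mul_assoc]
  rw [intervalIntegral.integral_add
    ((continuous_exp_mul_rhoPlus_exp x y).intervalIntegrable _ _)
    (Continuous.intervalIntegrable (by fun_prop) _ _), intervalIntegral.integral_mul_const,
    integral_exp_mul_re, mul_add]
  congr 1
  field_simp

/-- Although `ρ₊(x, ·)` need not be odd, the shift `θ ↦ θ + π` absorbs the sign into the periodic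
integrand. -/
theorem rhoInfty_neg_right (x y : X) : rhoInfty x (-y) = -rhoInfty x y := by
  unfold rhoInfty
  set f : ℝ → ℂ := fun θ => Complex.exp (θ * Complex.I)
      * (rhoPlus x (Complex.exp (θ * Complex.I) • y) : ℂ) with hf
  have hshift : ∀ θ : ℝ, Complex.exp (((θ + Real.pi : ℝ) : ℂ) * Complex.I)
      = -Complex.exp (θ * Complex.I) := by
    intro θ
    rw [Complex.ofReal_add, add_mul, Complex.exp_add, Complex.exp_pi_mul_I, mul_neg_one]
  have hper : Function.Periodic f (2 * Real.pi) := by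
    intro θ
    have : θ + 2 * Real.pi = θ + Real.pi + Real.pi := by ring
    simp only [hf, this, hshift, neg_neg]
  have e : ∀ θ : ℝ, Complex.exp (θ * Complex.I)
      * (rhoPlus x (Complex.exp (θ * Complex.I) • -y) : ℂ) = -f (θ + Real.pi) := by
    intro θ
    simp only [hf, hshift, smul_neg, neg_smul, neg_mul, neg_neg]
  simp only [e]
  rw [intervalIntegral.integral_neg, intervalIntegral.integral_comp_add_right,
    show 2 * Real.pi + Real.pi = (0 + Real.pi) + 2 * Real.pi by ring,
    hper.intervalIntegral_add_eq (0 + Real.pi) 0, zero_add, mul_neg]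

theorem re_rhoInfty (x y : X) :
    (rhoInfty x y).re = Real.pi⁻¹ * ∫ θ in (0 : ℝ)..(2 * Real.pi),
      Real.cos θ * rhoPlus x (Complex.exp (θ * Complex.I) • y) := by
  have h := Complex.reCLM.intervalIntegral_comp_comm
    ((continuous_exp_mul_rhoPlus_exp x y).intervalIntegrable (μ := volume) 0 (2 * Real.pi))
  simp only [Complex.reCLM_apply, Complex.re_mul_ofReal, Complex.exp_ofReal_mul_I_re] at h
  rw [h, rhoInfty, one_div, ← Complex.ofReal_inv, Complex.re_ofReal_mul]

/-- Comparison of the values of `ρ₊(x, ·)` at `y`, `e^{iθ} y` and `e^{i(θ + δ)} y`. -/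
theorem sin_add_mul_rhoPlus_le (x y : X) {θ δ : ℝ} (hδ : 0 ≤ Real.sin δ)
    (h : 0 ≤ Real.sin θ ∧ 0 ≤ Real.sin (θ + δ) ∨ Real.sin θ ≤ 0 ∧ Real.sin (θ + δ) ≤ 0) :
    Real.sin (θ + δ) * rhoPlus x (Complex.exp (θ * Complex.I) • y)
      ≤ Real.sin θ * rhoPlus x (Complex.exp ((θ + δ : ℝ) * Complex.I) • y)
        + Real.sin δ * rhoPlus x y := by
  have key : (Real.sin (θ + δ) : ℂ) * Complex.exp (θ * Complex.I)
      = Real.sin θ * Complex.exp ((θ + δ : ℝ) * Complex.I) + Real.sin δ := by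
    apply Complex.ext
    · simp only [Complex.add_re, Complex.re_ofReal_mul, Complex.exp_ofReal_mul_I_re,
        Complex.ofReal_re, Real.sin_add, Real.cos_add]
      linear_combination Real.sin δ * Real.sin_sq_add_cos_sq θ
    · simp only [Complex.add_im, Complex.im_ofReal_mul, Complex.exp_ofReal_mul_I_im,
        Complex.ofReal_im]
      ring
  rcases h with ⟨h1, h2⟩ | ⟨h1, h2⟩
  · rw [← rhoPlus_smul_of_nonneg x _ h1, ← rhoPlus_smul_of_nonneg x _ h2,
      ← rhoPlus_smul_of_nonneg x _ hδ]
    refine le_trans (le_of_eq ?_) (rhoPlus_add_le _ _ _)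
    rw [smul_smul, smul_smul, key, add_smul]
  · have h1' : 0 ≤ -Real.sin θ := by linarith
    have h2' : 0 ≤ -Real.sin (θ + δ) := by linarith
    have e : ((-Real.sin θ : ℝ) : ℂ) • Complex.exp ((θ + δ : ℝ) * Complex.I) • y
        = ((-Real.sin (θ + δ) : ℝ) : ℂ) • Complex.exp (θ * Complex.I) • y
          + (Real.sin δ : ℂ) • y := by
      rw [smul_smul, smul_smul, ← add_smul]
      congr 1
      rw [Complex.ofReal_neg, Complex.ofReal_neg]
      linear_combination key
    have h3 := rhoPlus_add_le x (((-Real.sin (θ + δ) : ℝ) : ℂ) • Complex.exp (θ * Complex.I) • y)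
      ((Real.sin δ : ℂ) • y)
    rw [← e, rhoPlus_smul_of_nonneg x _ h1', rhoPlus_smul_of_nonneg x _ h2',
      rhoPlus_smul_of_nonneg x _ hδ] at h3
    linarith

/-- The left side is the first coordinate of the boundary point with outer normal `e^{iθ}` in the
planar convex set with support function `p`; it is at most the support value in direction 1. -/
theorem cos_mul_rhoPlus_sub_sin_mul_deriv_le (x y : X) {θ : ℝ} (hθ : Real.sin θ ≠ 0)
    (hd : DifferentiableAt ℝ (fun θ : ℝ => rhoPlus x (Complex.exp (θ * Complex.I) • y)) θ) :
    Real.cos θ * rhoPlus x (Complex.exp (θ * Complex.I) • y)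
      - Real.sin θ * deriv (fun θ : ℝ => rhoPlus x (Complex.exp (θ * Complex.I) • y)) θ
      ≤ rhoPlus x y := by
  set p : ℝ → ℝ := fun θ => rhoPlus x (Complex.exp (θ * Complex.I) • y) with hp
  -- The slack in `sin_add_mul_rhoPlus_le`: zero at `δ = 0` and nonnegative for small `δ > 0`, so
  -- `φ'(0) ≥ 0`.
  set φ : ℝ → ℝ := fun δ => Real.sin θ * p (θ + δ) + Real.sin δ * rhoPlus x y
    - Real.sin (θ + δ) * p θ with hφ
  have hder : HasDerivAt φ (Real.sin θ * deriv p θ + Real.cos 0 * rhoPlus x y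
      - Real.cos (θ + 0) * p θ) 0 := by
    have h1 : HasDerivAt (fun δ => p (θ + δ)) (deriv p θ) 0 := by
      apply HasDerivAt.comp_const_add
      rw [add_zero]
      exact hd.hasDerivAt
    have h2 : HasDerivAt (fun δ => Real.sin (θ + δ)) (Real.cos (θ + 0)) 0 :=
      HasDerivAt.comp_const_add _ _ (Real.hasDerivAt_sin _)
    exact ((h1.const_mul _).add ((Real.hasDerivAt_sin 0).mul_const _)).sub (h2.mul_const _)
  have hφ0 : φ 0 = 0 := by simp [hφ]
  have hslope := hder.tendsto_slope_zero.mono_left (nhdsGT_le_nhdsNE 0)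
  have hsmall : ∀ᶠ δ in 𝓝[>] (0 : ℝ), 0 ≤ Real.sin δ := by
    filter_upwards [Ioo_mem_nhdsGT Real.pi_pos] with δ hδ
    exact Real.sin_nonneg_of_nonneg_of_le_pi hδ.1.le hδ.2.le
  have hcont : Tendsto (fun δ => Real.sin (θ + δ)) (𝓝[>] 0) (𝓝 (Real.sin θ)) := by
    have : Tendsto (fun δ => Real.sin (θ + δ)) (𝓝 0) (𝓝 (Real.sin (θ + 0))) :=
      Continuous.tendsto (by fun_prop) 0
    rw [add_zero] at this
    exact this.mono_left nhdsWithin_le_nhds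
  have hsign : ∀ᶠ δ in 𝓝[>] (0 : ℝ),
      0 ≤ Real.sin θ ∧ 0 ≤ Real.sin (θ + δ) ∨ Real.sin θ ≤ 0 ∧ Real.sin (θ + δ) ≤ 0 := by
    rcases hθ.lt_or_gt with h | h
    · filter_upwards [hcont.eventually_lt_const h] with δ hδ
      exact Or.inr ⟨h.le, hδ.le⟩
    · filter_upwards [hcont.eventually_const_lt h] with δ hδ
      exact Or.inl ⟨h.le, hδ.le⟩
  have hnonneg : 0 ≤ Real.sin θ * deriv p θ + Real.cos 0 * rhoPlus x y
      - Real.cos (θ + 0) * p θ := by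
    refine ge_of_tendsto hslope ?_
    filter_upwards [hsmall, hsign, self_mem_nhdsWithin] with δ h1 h2 h3
    have h3 : 0 < δ := h3
    have h4 := sin_add_mul_rhoPlus_le x y h1 h2
    rw [zero_add, hφ0, sub_zero, smul_eq_mul]
    refine mul_nonneg (by positivity) ?_
    simp only [hφ, hp]
    linarith
  simp only [Real.cos_zero, add_zero, one_mul] at hnonneg
  linarith

theorem ae_sin_ne_zero : ∀ᵐ θ : ℝ, Real.sin θ ≠ 0 := by
  have hc : {θ : ℝ | Real.sin θ = 0}.Countable := by
    refine (Set.countable_range (fun n : ℤ => (n : ℝ) * Real.pi)).mono fun θ hθ => ?_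
    exact Real.sin_eq_zero_iff.1 hθ
  filter_upwards [hc.ae_notMem volume] with θ hθ
  exact hθ

/-- `conj (ρ∞(x, y))` is the Steiner point of the convex set with support function
`w ↦ ρ₊(x, conj w • y)`; in particular it lies in this set. -/
theorem re_rhoInfty_le (x y : X) : (rhoInfty x y).re ≤ rhoPlus x y := by
  set p : ℝ → ℝ := fun θ => rhoPlus x (Complex.exp (θ * Complex.I) • y) with hp
  have hpac : AbsolutelyContinuousOnInterval p 0 (2 * Real.pi) :=
    ((lipschitzWith_rhoPlus_exp x y).lipschitzOnWith).absolutelyContinuousOnInterval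
  have hsac : AbsolutelyContinuousOnInterval Real.sin 0 (2 * Real.pi) :=
    (Real.contDiff_sin.contDiffOn).absolutelyContinuousOnInterval
  have hparts := hsac.integral_mul_deriv_eq_deriv_mul hpac
  simp only [Real.sin_two_pi, Real.sin_zero, zero_mul, sub_zero, zero_sub, Real.deriv_sin] at hparts
  have hi1 : IntervalIntegrable (fun θ => Real.cos θ * p θ) volume 0 (2 * Real.pi) :=
    (Real.continuous_cos.mul (continuous_rhoPlus_exp x y)).intervalIntegrable _ _
  have hi2 : IntervalIntegrable (fun θ => Real.sin θ * deriv p θ) volume 0 (2 * Real.pi) :=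
    hpac.intervalIntegrable_deriv.continuousOn_mul Real.continuous_sin.continuousOn
  -- By `hparts` both terms on the left contribute `∫ cos θ p(θ)`, so the left side is `2π Re ρ∞(x,
  -- y)`.
  have hle : ∫ θ in (0 : ℝ)..(2 * Real.pi), (Real.cos θ * p θ - Real.sin θ * deriv p θ)
      ≤ ∫ _ in (0 : ℝ)..(2 * Real.pi), rhoPlus x y := by
    refine intervalIntegral.integral_mono_ae Real.two_pi_pos.le (hi1.sub hi2) (by simp) ?_
    filter_upwards [ae_sin_ne_zero, (lipschitzWith_rhoPlus_exp x y).ae_differentiableAt_real]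
      with θ h1 h2
    exact cos_mul_rhoPlus_sub_sin_mul_deriv_le x y h1 h2
  rw [intervalIntegral.integral_sub hi1 hi2, hparts, intervalIntegral.integral_const,
    smul_eq_mul, sub_zero] at hle
  rw [re_rhoInfty, inv_mul_le_iff₀ Real.pi_pos]
  linarith

theorem neg_rhoPlus_neg_le_re_rhoInfty (x y : X) : -rhoPlus x (-y) ≤ (rhoInfty x y).re := by
  have h := re_rhoInfty_le x (-y)
  rw [rhoInfty_neg_right, Complex.neg_re] at h
  linarith

theorem re_rhoInfty_eq_of_hasDerivAt {x y : X} {t d : ℝ}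
    (h : HasDerivAt (fun s : ℝ => ‖x + (s : ℂ) • y‖ ^ 2) d t) :
    (rhoInfty (x + (t : ℂ) • y) y).re = d / 2 := by
  obtain ⟨h1, h2⟩ := rhoPlus_eq_of_hasDerivAt h
  have h3 := re_rhoInfty_le (x + (t : ℂ) • y) y
  have h4 := neg_rhoPlus_neg_le_re_rhoInfty (x + (t : ℂ) • y) y
  linarith

end RhoInfty

/-! ### Semi-inner products, and their invariance under an isometry. -/

section SemiInnerProduct

variable {X : Type*} [NormedAddCommGroup X] [NormedSpace ℂ X]

/-- For every line there is a functional of norm at most one which is isometric on that line. -/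
theorem exists_dual_isometric_on_span (X : Type*) [NormedAddCommGroup X] [NormedSpace ℂ X] :
    ∃ g : Submodule ℂ X → StrongDual ℂ X,
      ∀ y : X, ‖g (Submodule.span ℂ {y})‖ ≤ 1 ∧ ‖g (Submodule.span ℂ {y}) y‖ = ‖y‖ := by
  have h : ∀ L : Submodule ℂ X, ∃ g : StrongDual ℂ X,
      ∀ y : X, L = Submodule.span ℂ {y} → ‖g‖ ≤ 1 ∧ ‖g y‖ = ‖y‖ := by
    intro L
    by_cases hL : ∃ v : X, L = Submodule.span ℂ {v}
    · obtain ⟨v, hv⟩ := hL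
      obtain ⟨g, hg, hgv⟩ := exists_dual_vector'' ℂ v
      refine ⟨g, fun y hy => ⟨hg, ?_⟩⟩
      have hmem : y ∈ Submodule.span ℂ {v} := by
        rw [← hv, hy]; exact Submodule.mem_span_singleton_self y
      obtain ⟨a, rfl⟩ := Submodule.mem_span_singleton.1 hmem
      simp [hgv, norm_smul]
    · exact ⟨0, fun y hy => absurd ⟨y, hy⟩ hL⟩
  choose g hg using h
  exact ⟨g, fun y => hg _ y rfl⟩

/-- Choosing one functional per line, not per vector, is what makes conjugate homogeneity hold. -/
theorem exists_isSemiInnerProduct (X : Type*) [NormedAddCommGroup X] [NormedSpace ℂ X] :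
    ∃ s : X → X → ℂ, IsSemiInnerProduct s := by
  obtain ⟨g, hg⟩ := exists_dual_isometric_on_span X
  refine ⟨fun x y => g (Submodule.span ℂ {y}) x *
    (starRingEnd ℂ) (g (Submodule.span ℂ {y}) y), ?_, ?_, ?_, ?_⟩
  · intro α x y z
    simp only [map_add, map_smul, smul_eq_mul]
    ring
  · intro α x y
    rcases eq_or_ne α 0 with rfl | hα
    · simp
    · rw [Submodule.span_singleton_smul_eq (IsUnit.mk0 α hα)]
      simp only [map_smul, smul_eq_mul, map_mul]
      ring
  · intro x
    rw [Complex.mul_conj, Complex.normSq_eq_norm_sq, (hg x).2]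
  · intro x y
    rw [norm_mul, RCLike.norm_conj, (hg y).2]
    gcongr
    exact ((g _).le_of_opNorm_le (hg y).1 x).trans_eq (one_mul _)

theorem IsSemiInnerProduct.smul_left {s : X → X → ℂ} (hs : IsSemiInnerProduct s) (α : ℂ)
    (x z : X) : s (α • x) z = α * s x z := by
  have h0 : s 0 z = 0 := by
    have h := hs.norm_le 0 z
    rw [norm_zero, zero_mul] at h
    exact norm_le_zero_iff.1 h
  simpa [h0] using hs.linear_left α x 0 z

/-- The Cesàro means of a bounded sequence and of its shift are asymptotically equal. -/
theorem tendsto_cesaro_shift_sub {u : ℕ → ℂ} {C : ℝ} (hu : ∀ n, ‖u n‖ ≤ C) :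
    Tendsto (fun n : ℕ => ((n : ℂ) + 1)⁻¹ * ∑ k ∈ Finset.range (n + 1), u (k + 1)
      - ((n : ℂ) + 1)⁻¹ * ∑ k ∈ Finset.range (n + 1), u k) atTop (𝓝 0) := by
  refine squeeze_zero_norm (a := fun n : ℕ => 2 * C * (1 / ((n : ℝ) + 1))) (fun n => ?_) ?_
  · rw [← mul_sub, ← Finset.sum_sub_distrib, Finset.sum_range_sub, norm_mul, norm_inv]
    have h1 : ‖((n : ℂ) + 1)‖ = (n : ℝ) + 1 := by
      exact_mod_cast Complex.norm_natCast (n + 1)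
    rw [h1, mul_comm, one_div]
    gcongr
    refine (norm_sub_le _ _).trans ?_
    linarith [hu (n + 1), hu 0]
  · simpa using tendsto_one_div_add_atTop_nhds_zero_nat.const_mul (2 * C)

/-- A linear isometry leaves some semi-inner product invariant. -/
theorem exists_isSemiInnerProduct_invariant (U : X →ₗ[ℂ] X) (hU : ∀ x, ‖U x‖ = ‖x‖) :
    ∃ s : X → X → ℂ, IsSemiInnerProduct s ∧ ∀ x y, s (U x) (U y) = s x y := by
  obtain ⟨s, hs⟩ := exists_isSemiInnerProduct X
  have hUn : ∀ (n : ℕ) (x : X), ‖(U ^ n) x‖ = ‖x‖ := by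
    intro n
    induction n with
    | zero => simp
    | succ n ih => intro x; rw [pow_succ, Module.End.mul_apply, ih, hU]
  let a : X → X → ℕ → ℂ := fun x y n =>
    ((n : ℂ) + 1)⁻¹ * ∑ k ∈ Finset.range (n + 1), s ((U ^ k) x) ((U ^ k) y)
  have hsb : ∀ x y (k : ℕ), ‖s ((U ^ k) x) ((U ^ k) y)‖ ≤ ‖x‖ * ‖y‖ := fun x y k => by
    simpa only [hUn] using hs.norm_le ((U ^ k) x) ((U ^ k) y)
  have hab : ∀ x y n, ‖a x y n‖ ≤ ‖x‖ * ‖y‖ := by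
    intro x y n
    have h1 : ‖((n : ℂ) + 1)‖ = (n : ℝ) + 1 := by
      exact_mod_cast Complex.norm_natCast (n + 1)
    have h2 : ‖∑ k ∈ Finset.range (n + 1), s ((U ^ k) x) ((U ^ k) y)‖
        ≤ ((n : ℝ) + 1) * (‖x‖ * ‖y‖) := by
      refine (norm_sum_le_of_le _ fun k _ => hsb x y k).trans_eq ?_
      simp
    simp only [a]
    rw [norm_mul, norm_inv, h1, inv_mul_le_iff₀ (by positivity)]
    exact h2
  -- A single ultrafilter for all pairs makes the limits of the bounded means respect the algebraic
  -- identities.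
  have hex : ∀ x y, ∃ l : ℂ, Tendsto (a x y) (hyperfilter ℕ) (𝓝 l) := by
    intro x y
    obtain ⟨l, -, hl⟩ := (isCompact_closedBall (0 : ℂ) (‖x‖ * ‖y‖)).ultrafilter_le_nhds
      ((hyperfilter ℕ).map (a x y)) (by
        rw [le_principal_iff]
        exact Filter.mem_map.2 (Filter.univ_mem' fun n => by
          simpa using hab x y n))
    exact ⟨l, hl⟩
  choose r hr using hex
  refine ⟨r, ⟨?_, ?_, ?_, ?_⟩, ?_⟩
  · intro α x y z
    refine tendsto_nhds_unique (hr _ _) ((((hr x z).const_mul α).add (hr y z)).congr fun n => ?_)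
    simp only [a, map_add, map_smul, hs.linear_left, Finset.sum_add_distrib, ← Finset.mul_sum]
    ring
  · intro α x y
    refine tendsto_nhds_unique (hr _ _) (((hr x y).const_mul _).congr fun n => ?_)
    simp only [a, map_smul, hs.conj_smul_right, ← Finset.mul_sum]
    ring
  · intro x
    refine tendsto_nhds_unique (hr _ _) (tendsto_const_nhds.congr fun n => ?_)
    have : (n : ℂ) + 1 ≠ 0 := by exact_mod_cast Nat.succ_ne_zero n
    simp only [a, hs.self_eq, hUn]
    simp [this]
  · intro x y
    exact le_of_tendsto (hr x y).norm (Eventually.of_forall fun n => hab x y n)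
  · intro x y
    have h := ((tendsto_cesaro_shift_sub (hsb x y)).mono_left Nat.hyperfilter_le_atTop).add (hr x y)
    rw [zero_add] at h
    refine tendsto_nhds_unique (hr _ _) (h.congr fun n => ?_)
    simp [a, pow_succ]

end SemiInnerProduct

/-! ### Orthogonality preservers are multiples of isometries. -/

section Preservers

variable {X Y : Type*} [NormedAddCommGroup X] [NormedSpace ℂ X]
  [NormedAddCommGroup Y] [NormedSpace ℂ Y]

theorem PreservesRhoInftyOrthogonality.norm_sq_mul_rhoInfty {T : X →L[ℂ] Y}
    (hT : PreservesRhoInftyOrthogonality (fun x => T x)) (x y : X) :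
    ((‖x‖ ^ 2 : ℝ) : ℂ) * rhoInfty (T x) (T y) = ((‖T x‖ ^ 2 : ℝ) : ℂ) * rhoInfty x y := by
  rcases eq_or_ne x 0 with rfl | hx
  · simp
  have hx' : ((‖x‖ ^ 2 : ℝ) : ℂ) ≠ 0 := by
    exact_mod_cast pow_ne_zero 2 (norm_ne_zero_iff.2 hx)
  -- The multiple of `x` that makes `y + μ • x` orthogonal to `x`.
  set μ : ℂ := (starRingEnd ℂ) (-(rhoInfty x y / ((‖x‖ ^ 2 : ℝ) : ℂ))) with hμ
  have h0 : rhoInfty x (y + μ • x) = 0 := by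
    rw [rhoInfty_add_smul_self, hμ, Complex.conj_conj]
    field_simp
    ring
  have h1 : rhoInfty (T x) (T (y + μ • x)) = 0 := hT x _ h0
  rw [map_add, map_smul, rhoInfty_add_smul_self, hμ, Complex.conj_conj] at h1
  field_simp at h1
  linear_combination h1

theorem lipschitzWith_norm_add_smul (x y : X) :
    LipschitzWith ‖y‖₊ (fun t : ℝ => ‖x + (t : ℂ) • y‖) := by
  refine LipschitzWith.of_dist_le_mul fun a b => ?_
  rw [Real.dist_eq, Real.dist_eq]
  refine (abs_norm_sub_norm_le _ _).trans_eq ?_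
  rw [add_sub_add_left_eq_sub, ← sub_smul, norm_smul, ← Complex.ofReal_sub, Complex.norm_real,
    Real.norm_eq_abs, mul_comm, coe_nnnorm]

/-- On a compact interval `f` is bounded below by its positive minimum, so `1/f` is Lipschitz there.
-/
theorem absolutelyContinuousOnInterval_inv {f : ℝ → ℝ} {K : NNReal} {a b : ℝ}
    (hf : LipschitzWith K f) (hpos : ∀ t, 0 < f t) :
    AbsolutelyContinuousOnInterval (fun t => (f t)⁻¹) a b := by
  obtain ⟨t₀, -, ht₀⟩ := isCompact_uIcc.exists_isMinOn (s := Set.uIcc a b) Set.nonempty_uIcc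
    hf.continuous.continuousOn
  have hm := hpos t₀
  have hlip : LipschitzOnWith (K * Real.toNNReal ((f t₀)⁻¹ ^ 2)) (fun t => (f t)⁻¹)
      (Set.uIcc a b) := by
    refine LipschitzOnWith.of_dist_le_mul fun s hs t ht => ?_
    have h1 := hpos s
    have h2 := hpos t
    have hs' : f t₀ ≤ f s := ht₀ hs
    have ht' : f t₀ ≤ f t := ht₀ ht
    have h3 : (f s)⁻¹ - (f t)⁻¹ = (f t - f s) * ((f s)⁻¹ * (f t)⁻¹) := by field_simp
    rw [Real.dist_eq, h3, abs_mul, abs_of_pos (a := (f s)⁻¹ * (f t)⁻¹) (by positivity),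
      NNReal.coe_mul, Real.coe_toNNReal _ (by positivity), mul_right_comm, sq]
    have h4 := hf.dist_le_mul s t
    rw [Real.dist_eq, abs_sub_comm] at h4
    gcongr
  exact hlip.absolutelyContinuousOnInterval

theorem PreservesRhoInftyOrthogonality.norm_mul_norm_add {T : X →L[ℂ] Y}
    (hT : PreservesRhoInftyOrthogonality (fun x => T x)) {x y : X}
    (hxy : ∀ t : ℝ, x + (t : ℂ) • y ≠ 0) :
    ‖T (x + y)‖ * ‖x‖ = ‖T x‖ * ‖x + y‖ := by
  set f : ℝ → ℝ := fun t => ‖T x + (t : ℂ) • T y‖ with hf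
  set g : ℝ → ℝ := fun t => ‖x + (t : ℂ) • y‖ with hg
  have hfl : LipschitzWith ‖T y‖₊ f := lipschitzWith_norm_add_smul (T x) (T y)
  have hgl : LipschitzWith ‖y‖₊ g := lipschitzWith_norm_add_smul x y
  have hgpos : ∀ t, 0 < g t := fun t => norm_pos_iff.2 (hxy t)
  have hac : AbsolutelyContinuousOnInterval (fun t => f t * (g t)⁻¹) 0 1 :=
    (hfl.lipschitzOnWith.absolutelyContinuousOnInterval).fun_mul
      (absolutelyContinuousOnInterval_inv hgl hgpos)
  -- The numerator of the derivative of `f² / g²` vanishes by `norm_sq_mul_rhoInfty` at `x + ty`.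
  have hder : ∀ᵐ t : ℝ, t ∈ Set.uIcc (0 : ℝ) 1 →
      HasDerivAt (fun t => (f t * (g t)⁻¹) * (f t * (g t)⁻¹)) 0 t := by
    filter_upwards [hfl.ae_differentiableAt_real, hgl.ae_differentiableAt_real] with t h1 h2 _
    have hF : HasDerivAt (fun t => f t ^ 2) _ t := h1.hasDerivAt.pow 2
    have hG : HasDerivAt (fun t => g t ^ 2) _ t := h2.hasDerivAt.pow 2
    have hq := hF.fun_div hG (pow_ne_zero 2 (hgpos t).ne')
    have e1 := re_rhoInfty_eq_of_hasDerivAt hF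
    have e2 := re_rhoInfty_eq_of_hasDerivAt hG
    have e3 := congrArg Complex.re (hT.norm_sq_mul_rhoInfty (x + (t : ℂ) • y) y)
    have e4 : T (x + (t : ℂ) • y) = T x + (t : ℂ) • T y := by simp
    rw [Complex.re_ofReal_mul, Complex.re_ofReal_mul, e4, e1, e2] at e3
    have e5 : g t ^ 2 = ‖x + (t : ℂ) • y‖ ^ 2 := rfl
    have e6 : f t ^ 2 = ‖T x + (t : ℂ) • T y‖ ^ 2 := rfl
    rw [← e5, ← e6] at e3
    refine (hq.congr_deriv ?_).congr_of_eventuallyEq (Eventually.of_forall fun s => ?_)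
    · rw [div_eq_zero_iff]
      left
      linear_combination 2 * e3
    · simp only [div_eq_mul_inv]
      ring
  obtain ⟨C, hC⟩ := (hac.fun_mul hac).const_of_ae_hasDerivAt_zero hder
  have h01 := (hC 1 (by simp)).trans (hC 0 (by simp)).symm
  have h0 : 0 ≤ f 0 * (g 0)⁻¹ := mul_nonneg (norm_nonneg _) (inv_nonneg.2 (norm_nonneg _))
  have h1 : 0 ≤ f 1 * (g 1)⁻¹ := mul_nonneg (norm_nonneg _) (inv_nonneg.2 (norm_nonneg _))
  have h := (mul_self_inj h1 h0).1 h01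
  have hg0 := (hgpos 0).ne'
  have hg1 := (hgpos 1).ne'
  field_simp at h
  simpa [hf, hg, mul_comm ‖x + y‖] using h

theorem PreservesRhoInftyOrthogonality.norm_mul_norm {T : X →L[ℂ] Y}
    (hT : PreservesRhoInftyOrthogonality (fun x => T x)) (x y : X) :
    ‖T x‖ * ‖y‖ = ‖T y‖ * ‖x‖ := by
  by_cases hdep : ∃ a : ℂ, x = a • y
  · obtain ⟨a, rfl⟩ := hdep
    rw [map_smul, norm_smul, norm_smul]
    ring
  rcases eq_or_ne y 0 with rfl | hy
  · simp
  -- By independence, the real lines joining `x` and `y` to `x + y` avoid 0, so both norm ratios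
  -- equal the one at `x + y`.
  have hx : ∀ t : ℝ, x + (t : ℂ) • y ≠ 0 := fun t ht =>
    hdep ⟨-t, by rw [neg_smul]; exact eq_neg_of_add_eq_zero_left ht⟩
  have hy' : ∀ t : ℝ, y + (t : ℂ) • x ≠ 0 := by
    intro t ht
    rcases eq_or_ne t 0 with rfl | h0
    · simp [hy] at ht
    · have h0' : (t : ℂ) ≠ 0 := by exact_mod_cast h0
      refine hdep ⟨-(t : ℂ)⁻¹, ?_⟩
      rw [eq_neg_of_add_eq_zero_left ht, smul_neg, neg_smul, neg_neg, smul_smul,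
        inv_mul_cancel₀ h0', one_smul]
  have h1 := hT.norm_mul_norm_add hx
  have h2 := hT.norm_mul_norm_add hy'
  rw [add_comm y x] at h2
  have hxy : ‖x + y‖ ≠ 0 := by simpa using hx 1
  refine mul_right_cancel₀ hxy ?_
  linear_combination (-‖y‖) * h1 + ‖x‖ * h2

theorem norm_map_eq_of_norm_mul_norm {T : X →L[ℂ] Y}
    (h : ∀ x y, ‖T x‖ * ‖y‖ = ‖T y‖ * ‖x‖) (x : X) : ‖T x‖ = ‖T‖ * ‖x‖ := by
  refine le_antisymm (T.le_opNorm x) ?_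
  rcases eq_or_ne x 0 with rfl | hx
  · simp
  have hx' : 0 < ‖x‖ := norm_pos_iff.2 hx
  rw [← le_div_iff₀ hx']
  refine T.opNorm_le_bound (by positivity) fun y => ?_
  rw [div_mul_eq_mul_div, le_div_iff₀ hx', h x y]

theorem rhoPlus_map_of_norm_map {T : X →L[ℂ] Y} {c : ℝ} (h : ∀ x, ‖T x‖ = c * ‖x‖) (x y : X) :
    rhoPlus (T x) (T y) = c ^ 2 * rhoPlus x y := by
  refine rhoPlus_eq_of_tendsto (((tendsto_rhoPlus x y).const_mul (c ^ 2)).congr fun t => ?_)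
  rw [← map_smul, ← map_add, h, h]
  ring

theorem rhoInfty_map_of_norm_map {T : X →L[ℂ] Y} {c : ℝ} (h : ∀ x, ‖T x‖ = c * ‖x‖) (x y : X) :
    rhoInfty (T x) (T y) = ((c ^ 2 : ℝ) : ℂ) * rhoInfty x y := by
  unfold rhoInfty
  rw [mul_left_comm, ← intervalIntegral.integral_const_mul ((c ^ 2 : ℝ) : ℂ)]
  simp only [← map_smul, rhoPlus_map_of_norm_map h, Complex.ofReal_mul, mul_left_comm]

theorem tfae_preservesRhoInftyOrthogonality (T : X →L[ℂ] Y) :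
    List.TFAE [
      PreservesRhoInftyOrthogonality (fun x => T x),
      ∀ x : X, ‖T x‖ = ‖T‖ * ‖x‖,
      ∀ x y : X, rhoInfty (T x) (T y) = ((‖T‖ ^ 2 : ℝ) : ℂ) * rhoInfty x y] := by
  tfae_have 1 → 2 := fun h => norm_map_eq_of_norm_mul_norm h.norm_mul_norm
  tfae_have 2 → 3 := fun h => rhoInfty_map_of_norm_map h
  tfae_have 3 → 1 := fun h x y hxy => by
    have hxy : rhoInfty x y = 0 := hxy
    simp only [RhoInftyOrthogonal, h, hxy, mul_zero]
  tfae_finish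

theorem norm_map_eq_iff_exists_isSemiInnerProduct {T : X →L[ℂ] X} (hT : T ≠ 0) :
    (∀ x : X, ‖T x‖ = ‖T‖ * ‖x‖) ↔
      ∃ s : X → X → ℂ, IsSemiInnerProduct s ∧
        ∀ x y : X, s (T x) (T y) = ((‖T‖ ^ 2 : ℝ) : ℂ) * s x y := by
  have hc : ‖T‖ ≠ 0 := norm_ne_zero_iff.2 hT
  have hc' : (‖T‖ : ℂ) ≠ 0 := by exact_mod_cast hc
  constructor
  · intro h
    obtain ⟨s, hs, hinv⟩ := exists_isSemiInnerProduct_invariant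
      ((‖T‖ : ℂ)⁻¹ • (T : X →ₗ[ℂ] X)) (fun x => by
        simp [norm_smul, h, hc])
    refine ⟨s, hs, fun x y => ?_⟩
    rw [← hinv x y]
    simp only [LinearMap.smul_apply, ContinuousLinearMap.coe_coe, hs.smul_left,
      hs.conj_smul_right, map_inv₀, Complex.conj_ofReal, Complex.ofReal_pow]
    field_simp
  · rintro ⟨s, hs, h⟩ x
    have h1 := h x x
    rw [hs.self_eq, hs.self_eq, ← Complex.ofReal_mul, Complex.ofReal_inj, ← mul_pow] at h1
    exact (sq_eq_sq₀ (norm_nonneg _) (by positivity)).1 h1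

end Preservers

end RhoInfty

theorem mainTheorem1 {X Y : Type*} [NormedAddCommGroup X] [NormedSpace ℂ X]
    [NormedAddCommGroup Y] [NormedSpace ℂ Y] :
    (∀ T : X →L[ℂ] Y, T ≠ 0 →
      List.TFAE [
        RhoInfty.PreservesRhoInftyOrthogonality (fun x => T x),
        ∀ x : X, ‖T x‖ = ‖T‖ * ‖x‖,
        ∀ x y : X,
          RhoInfty.rhoInfty (T x) (T y) = ((‖T‖ ^ 2 : ℝ) : ℂ) * RhoInfty.rhoInfty x y]) ∧
    (∀ T : X →L[ℂ] X, T ≠ 0 →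
      List.TFAE [
        RhoInfty.PreservesRhoInftyOrthogonality (fun x => T x),
        ∀ x : X, ‖T x‖ = ‖T‖ * ‖x‖,
        ∀ x y : X,
          RhoInfty.rhoInfty (T x) (T y) = ((‖T‖ ^ 2 : ℝ) : ℂ) * RhoInfty.rhoInfty x y,
        ∃ s : X → X → ℂ, RhoInfty.IsSemiInnerProduct s ∧
          ∀ x y : X, s (T x) (T y) = ((‖T‖ ^ 2 : ℝ) : ℂ) * s x y]) := by
  refine ⟨fun T _ => RhoInfty.tfae_preservesRhoInftyOrthogonality T, fun T hT => ?_⟩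
  have h := RhoInfty.tfae_preservesRhoInftyOrthogonality T
  tfae_have 1 ↔ 2 := h.out 0 1
  tfae_have 2 ↔ 3 := h.out 1 2
  tfae_have 2 ↔ 4 := RhoInfty.norm_map_eq_iff_exists_isSemiInnerProduct hT
  tfae_finish
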